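/- Let $G$ and $H$ be finite trees on the same vertex set $V$. For a finite simple graph $F$ on $V$ and a vertex $v \in V$, the local complementation $F*v$ is the graph on $V$ obtained from $F$ by replacing the subgraph induced on the set $N_F(v)$ of neighbours of $v$ by its complement (two distinct neighbours of $v$ are adjacent in $F*v$ if and only if they are not adjacent in $F$; all other adjacencies are unchanged). Suppose that $G$ and $H$ are locally equivalent, that is, $H$ can be obtained from $G$ by a finite (possibly empty) sequence of local complementations. Then $G$ and $H$ are isomorphic. -/

import Mathlib

namespace SimpleGraph

/-- The local complementation `G * v` of a graph `G` at a vertex `v`: the subgraph induced on the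
neighbourhood of `v` is replaced by its complement, all other adjacencies are kept. -/
def localComplement {V : Type*} (G : SimpleGraph V) (v : V) : SimpleGraph V where
  Adj x y :=
    (x ∈ G.neighborSet v ∧ y ∈ G.neighborSet v ∧ x ≠ y ∧ ¬ G.Adj x y) ∨
    (¬ (x ∈ G.neighborSet v ∧ y ∈ G.neighborSet v) ∧ G.Adj x y)
  symm := ⟨by
    rintro x y (⟨hx, hy, hne, h⟩ | ⟨hn, h⟩)
    · exact Or.inl ⟨hy, hx, hne.symm, fun h' => h h'.symm⟩
    · exact Or.inr ⟨fun h' => hn ⟨h'.2, h'.1⟩, h.symm⟩⟩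
  loopless := ⟨by
    rintro x (⟨-, -, hne, -⟩ | ⟨-, h⟩)
    · exact hne rfl
    · exact G.irrefl h⟩

/-- `H` is locally equivalent to `G` if it is obtained from `G` by a finite (possibly empty)
sequence of local complementations. -/
def LocallyEquivalent {V : Type*} (G H : SimpleGraph V) : Prop :=
  Relation.ReflTransGen (fun G₁ G₂ : SimpleGraph V => ∃ v : V, G₂ = G₁.localComplement v) G H

end SimpleGraph

/-!
Locally equivalent finite forests, hence locally equivalent trees, are isomorphic.

Let `A` be the adjacency matrix of `G` over the field with two elements. For a set `X` of vertices
consider the vectors supported in `X` whose image under `A` is supported in `X` as well. Their number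
is `2 ^ (|X| - ρ X)`, where `ρ X` is the cut-rank, and it is invariant under local complementation
(`cutEquivalent_localComplement`): adding `(A p) v` to the coordinate `v` of `p` maps the vectors for
`G` to those for `G * v`. From this point on only these numbers are used, through the relation
`CutEquivalent`.

Call `u` pendant at `w` if `w` is the only neighbour of `u`. The numbers for two-element sets show that
if `u` is pendant at `w` in `G` and `H` is a forest cut-equivalent to `G`, then in `H` either `u` is
pendant at `w`, or `w` is pendant at `u`, or both are pendant at the same vertex
(`CutEquivalent.isPendantAt_or`). So the two forests have the same clusters consisting of a vertex and
the leaves attached to it, and may differ only in which member of a cluster is its centre. Exchanging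
the names of a leaf `a` and its neighbour `b` in a forest amounts to local complementation at `b` and
then at `a`, so it yields an isomorphic and cut-equivalent forest; finitely many such exchanges make
the pendant pairs of `H` agree with those of `G` (`CutEquivalent.exists_iso_isPendantAt`,
`CutEquivalent.isPendantAt_iff`).

Cut-equivalent forests with the same pendant pairs are equal
(`CutEquivalent.eq_of_isPendantAt_iff`). Choose a vertex `w` with at least one leaf attached and at
most one neighbour `t` that is not a leaf, and cut off the leaves at `w`. The smaller forests are
again cut-equivalent. In the one from `G`, either `w` is isolated, or `w` has become pendant at `t`;
as `t` is not a leaf, the trichotomy above forces the same in the one from `H`. Thus the smaller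
forests have the same pendant pairs too, and induction applies.
-/

namespace SimpleGraph

variable {V : Type*}

/-! ### Kernels of cuts and local complementation -/

open Classical in
/-- The vectors over the field with two elements that vanish outside `X` and whose image under the
adjacency matrix vanishes outside `X`. They form the kernel of the submatrix with rows `Xᶜ` and
columns `X`, extended by zero; so there are `2 ^ (|X| - ρ X)` of them, with `ρ` the cut-rank. -/
def cutKernel [Fintype V] (G : SimpleGraph V) (X : Set V) : Set (V → ZMod 2) :=
  {p | ∀ y ∉ X, p y = 0 ∧ (G.adjMatrix (ZMod 2)).mulVec p y = 0}

/-- Two graphs on the same vertices are cut-equivalent if their cut-rank functions agree, expressed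
here as equality of the cardinalities of all cut kernels. -/
def CutEquivalent [Fintype V] (G H : SimpleGraph V) : Prop :=
  ∀ X : Set V, (G.cutKernel X).ncard = (H.cutKernel X).ncard

lemma localComplement_adj_self {G : SimpleGraph V} {v z : V} :
    (G.localComplement v).Adj v z ↔ G.Adj v z := by
  simp [localComplement]

lemma localComplement_localComplement (G : SimpleGraph V) (v : V) :
    (G.localComplement v).localComplement v = G := by
  ext x y
  have := G.ne_of_adj (a := x) (b := y)
  simp only [localComplement, mem_neighborSet]
  by_cases hx : G.Adj v x <;> by_cases hy : G.Adj v y <;> simp [hx, hy]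
  tauto

open Classical in
lemma add_single_mem_cutKernel_localComplement [Fintype V] (G : SimpleGraph V) (v : V) (X : Set V)
    {p : V → ZMod 2} (hp : p ∈ G.cutKernel X) :
    p + Pi.single v ((G.adjMatrix (ZMod 2)).mulVec p v) ∈ (G.localComplement v).cutKernel X := by
  intro y hy
  obtain ⟨hpy, hAy⟩ := hp y hy
  refine ⟨?_, ?_⟩
  · rcases eq_or_ne y v with rfl | h
    · simp [hpy, hAy]
    · simp [hpy, h]
  · have key : ((G.localComplement v).adjMatrix (ZMod 2)).mulVec p y =
        (G.adjMatrix (ZMod 2)).mulVec p y +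
          G.adjMatrix (ZMod 2) v y * (G.adjMatrix (ZMod 2)).mulVec p v := by
      simp only [Matrix.mulVec, dotProduct, Finset.mul_sum, ← Finset.sum_add_distrib]
      refine Finset.sum_congr rfl fun z _ => ?_
      -- The formula fails for the diagonal entry at `y`, but there `p y = 0`.
      rcases eq_or_ne y z with rfl | hne
      · simp [hpy]
      · simp only [adjMatrix_apply, localComplement, mem_neighborSet]
        have h2 : p z + p z = 0 := CharTwo.add_self_eq_zero _
        by_cases h1 : G.Adj v y <;> by_cases h3 : G.Adj v z <;> by_cases h4 : G.Adj y z <;>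
          simp [h1, h3, h4, hne, h2]
    rw [Matrix.mulVec_add, Pi.add_apply, key, hAy, Matrix.mulVec_single]
    have : (G.localComplement v).Adj y v ↔ G.Adj v y := by
      rw [adj_comm, localComplement_adj_self]
    simp [this, CharTwo.add_self_eq_zero]

open Classical in
lemma ncard_cutKernel_le_localComplement [Fintype V] (G : SimpleGraph V) (v : V) (X : Set V) :
    (G.cutKernel X).ncard ≤ ((G.localComplement v).cutKernel X).ncard := by
  refine Set.ncard_le_ncard_of_injOn _
    (fun p hp => add_single_mem_cutKernel_localComplement G v X hp) ?_ (Set.toFinite _)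
  intro p _ q _ h
  have h1 : (G.adjMatrix (ZMod 2)).mulVec p v = (G.adjMatrix (ZMod 2)).mulVec q v := by
    have := congrArg (fun r => (G.adjMatrix (ZMod 2)).mulVec r v) h
    simpa [-adjMatrix_mulVec_apply, Matrix.mulVec_add, Matrix.mulVec_single] using this
  simpa [h1] using h

lemma cutEquivalent_localComplement [Fintype V] (G : SimpleGraph V) (v : V) :
    G.CutEquivalent (G.localComplement v) := fun X =>
  (ncard_cutKernel_le_localComplement G v X).antisymm
    ((ncard_cutKernel_le_localComplement _ v X).trans_eq (by rw [localComplement_localComplement]))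

lemma LocallyEquivalent.cutEquivalent [Fintype V] {G H : SimpleGraph V}
    (h : G.LocallyEquivalent H) : G.CutEquivalent H := by
  induction h with
  | refl => exact fun _ => rfl
  | tail _ h ih =>
    obtain ⟨v, rfl⟩ := h
    exact fun X => (ih X).trans (cutEquivalent_localComplement _ v X)

open Classical in
/-- The cut kernel of `X` is as large as possible exactly when no edge leaves `X`. -/
lemma supported_subset_cutKernel_iff [Fintype V] (G : SimpleGraph V) (X : Set V) :
    {p : V → ZMod 2 | ∀ y ∉ X, p y = 0} ⊆ G.cutKernel X ↔
      ∀ x ∈ X, ∀ y ∉ X, ¬ G.Adj x y := by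
  constructor
  · intro h x hx y hy hxy
    have := (h (a := Pi.single x 1) (fun z hz => Pi.single_eq_of_ne (by grind) _) y hy).2
    simp [hxy.symm] at this
  · intro h p hp y hy
    refine ⟨hp y hy, ?_⟩
    simp only [Matrix.mulVec, dotProduct]
    refine Finset.sum_eq_zero fun z _ => ?_
    by_cases hz : z ∈ X
    · simp [mt Adj.symm (h z hz y hy)]
    · simp [hp z hz]

/-- Cut-equivalent graphs have the same unions of connected components. -/
lemma CutEquivalent.not_adj_of_not_adj [Fintype V] {G H : SimpleGraph V} (h : G.CutEquivalent H)
    {X : Set V} (hG : ∀ x ∈ X, ∀ y ∉ X, ¬ G.Adj x y) : ∀ x ∈ X, ∀ y ∉ X, ¬ H.Adj x y := by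
  have h1 := (supported_subset_cutKernel_iff G X).2 hG
  have hsub : H.cutKernel X ⊆ {p : V → ZMod 2 | ∀ y ∉ X, p y = 0} := fun p hp y hy => (hp y hy).1
  rw [← supported_subset_cutKernel_iff]
  refine (Set.eq_of_subset_of_ncard_le hsub ?_ (Set.toFinite _)).ge
  rw [← h X]
  exact Set.ncard_le_ncard h1 (Set.toFinite _)

lemma CutEquivalent.symm [Fintype V] {G H : SimpleGraph V} (h : G.CutEquivalent H) :
    H.CutEquivalent G := fun X => (h X).symm

lemma CutEquivalent.trans [Fintype V] {G H K : SimpleGraph V} (h : G.CutEquivalent H)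
    (h' : H.CutEquivalent K) : G.CutEquivalent K := fun X => (h X).trans (h' X)

lemma CutEquivalent.exists_adj [Fintype V] {G H : SimpleGraph V} (h : G.CutEquivalent H)
    {u w : V} (hu : G.Adj u w) : ∃ z, H.Adj u z := by
  by_contra! hn
  exact h.symm.not_adj_of_not_adj (X := {u}) (by simpa using fun y _ => hn y) u rfl w
    hu.ne' hu

/-- The vertex `u` is a leaf with unique neighbour `w`. On an isolated edge each end is pendant at the
other. -/
def IsPendantAt (G : SimpleGraph V) (u w : V) : Prop := ∀ z, G.Adj u z ↔ z = w

lemma IsPendantAt.adj {G : SimpleGraph V} {u w : V} (h : G.IsPendantAt u w) : G.Adj u w :=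
  (h w).2 rfl

/-- A forest has no cycle of length four. -/
lemma IsAcyclic.eq_of_adj_adj {G : SimpleGraph V} (hG : G.IsAcyclic) {u w x y : V} (hne : u ≠ w)
    (hux : G.Adj u x) (hxw : G.Adj x w) (huy : G.Adj u y) (hyw : G.Adj y w) : x = y := by
  have h := (hG.subsingleton_path u w).elim
    ⟨.cons hux (.cons hxw .nil), by simp [hux.ne, hxw.ne, hne]⟩
    ⟨.cons huy (.cons hyw .nil), by simp [huy.ne, hyw.ne, hne]⟩
  have := congrArg (fun p : G.Path u w => p.1.snd) h
  simpa using this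

/-- A forest has no triangle. -/
lemma IsAcyclic.not_adj_of_adj_adj {G : SimpleGraph V} (hG : G.IsAcyclic) {u w x : V}
    (hux : G.Adj u x) (hxw : G.Adj x w) : ¬ G.Adj u w := by
  intro h
  have h' := (hG.subsingleton_path u w).elim
    ⟨.cons hux (.cons hxw .nil), by simp [hux.ne, hxw.ne, h.ne]⟩
    ⟨.cons h .nil, by simp [h.ne]⟩
  have := congrArg (fun p : G.Path u w => p.1.length) h'
  simp at this

open Classical in
/-- If `u` is pendant at `w`, then the cut kernel of `{u, w}` contains the indicator of `u`. A nonzero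
vector in the cut kernel of `{u, w}` for the forest `H` is the indicator of `u`, of `w`, or of
`{u, w}`; in the last case `u` and `w` have the same neighbours outside `{u, w}`, of which a forest
allows at most one. -/
lemma CutEquivalent.isPendantAt_or [Fintype V] {G H : SimpleGraph V} (h : G.CutEquivalent H)
    (hH : H.IsAcyclic) {u w : V} (huw : G.IsPendantAt u w) :
    H.IsPendantAt u w ∨ H.IsPendantAt w u ∨ ∃ x, H.IsPendantAt u x ∧ H.IsPendantAt w x := by
  obtain ⟨a, ha⟩ := h.exists_adj huw.adj
  obtain ⟨b, hb⟩ := h.exists_adj huw.adj.symm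
  have hne := huw.adj.ne
  have pend : ∀ {x y z}, H.Adj x z → (∀ c, c ≠ x → c ≠ y → ¬ H.Adj x c) → H.IsPendantAt x y := by
    intro x y z hz hc c
    have h1 : z = y := by
      by_contra hzy
      exact hc z hz.ne' hzy hz
    subst h1
    exact ⟨fun h2 => by_contra fun h3 => hc c h2.ne' h3 h2, fun h2 => h2 ▸ hz⟩
  -- The kernel for `G` contains `0` and the indicator of `u`, so the one for `H` is not zero either.
  obtain ⟨p, hp, hp0⟩ : ∃ p ∈ H.cutKernel {u, w}, p ≠ 0 := by
    have hmem : ({0, Pi.single u 1} : Set (V → ZMod 2)) ⊆ G.cutKernel {u, w} := by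
      rintro p (rfl | rfl) y hy
      · simp
      · have : ¬ G.Adj y u := fun h1 => hy (by simp [(huw y).1 h1.symm])
        have hyu : y ≠ u := by grind
        simp [this, hyu]
    have h2 := Set.ncard_le_ncard hmem (Set.toFinite _)
    rw [h, Set.ncard_pair (by simp [eq_comm])] at h2
    exact Set.exists_ne_of_one_lt_ncard (by omega) 0
  have hsum : ∀ y ∉ ({u, w} : Set V), (H.adjMatrix (ZMod 2)).mulVec p y =
      H.adjMatrix (ZMod 2) y u * p u + H.adjMatrix (ZMod 2) y w * p w := by
    intro y hy
    have : p = Pi.single u (p u) + Pi.single w (p w) := by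
      funext z
      by_cases hzu : z = u
      · subst hzu; simp [hne]
      · by_cases hzw : z = w
        · subst hzw; simp [hzu]
        · simp [hzu, hzw, (hp z (by grind)).1]
    conv_lhs => rw [this]
    simp [-adjMatrix_mulVec_apply, Matrix.mulVec_add, Matrix.mulVec_single]
  have hz2 : ∀ c : ZMod 2, c = 0 ∨ c = 1 := by decide
  have hcond : ∀ y, y ≠ u → y ≠ w →
      H.adjMatrix (ZMod 2) y u * p u + H.adjMatrix (ZMod 2) y w * p w = 0 := fun y h1 h2 =>
    (hsum y (by grind)).symm.trans (hp y (by grind)).2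
  rcases hz2 (p u) with hu | hu <;> rcases hz2 (p w) with hw | hw
  · refine absurd (funext fun z => ?_) hp0
    by_cases hz : z ∈ ({u, w} : Set V)
    · rcases hz with rfl | rfl <;> simpa
    · exact (hp z hz).1
  · refine .inr (.inl (pend hb fun c h1 h2 h3 => ?_))
    simpa [hu, hw, h3.symm] using hcond c h2 h1
  · refine .inl (pend ha fun c h1 h2 h3 => ?_)
    simpa [hu, hw, h3.symm] using hcond c h1 h2
  · have hiff : ∀ y, y ≠ u → y ≠ w → (H.Adj u y ↔ H.Adj w y) := by
      intro y h1 h2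
      have := hcond y h1 h2
      rw [H.adj_comm u, H.adj_comm w]
      by_cases h3 : H.Adj y u <;> by_cases h4 : H.Adj y w <;> simp [hu, hw, h3, h4] at this ⊢
    by_cases hx : ∃ x, x ≠ u ∧ x ≠ w ∧ H.Adj u x
    · obtain ⟨x, hxu, hxw, hux⟩ := hx
      have hwx := (hiff x hxu hxw).1 hux
      have huw' := hH.not_adj_of_adj_adj hux hwx.symm
      refine .inr (.inr ⟨x, fun y => ⟨fun hy => ?_, fun hy => hy ▸ hux⟩,
        fun y => ⟨fun hy => ?_, fun hy => hy ▸ hwx⟩⟩)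
      · have h1 : y ≠ w := fun h => huw' (h ▸ hy)
        exact hH.eq_of_adj_adj hne hy ((hiff y hy.ne' h1).1 hy).symm hux hwx.symm
      · have h1 : y ≠ u := fun h => huw' (h ▸ hy).symm
        exact hH.eq_of_adj_adj hne ((hiff y h1 hy.ne').2 hy) hy.symm hux hwx.symm
    · push Not at hx
      exact .inl (pend ha fun c h1 h2 => hx c h1 h2)

/-! ### Cutting off leaves -/

open Classical in
lemma cutKernel_congr [Fintype V] {G H : SimpleGraph V} {X : Set V}
    (h : ∀ y ∉ X, ∀ z ∈ X, G.Adj y z ↔ H.Adj y z) : G.cutKernel X = H.cutKernel X := by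
  ext p
  have key : (∀ y ∉ X, p y = 0) → ∀ y ∉ X,
      (G.adjMatrix (ZMod 2)).mulVec p y = (H.adjMatrix (ZMod 2)).mulVec p y := by
    intro hp y hy
    simp only [Matrix.mulVec, dotProduct]
    refine Finset.sum_congr rfl fun z _ => ?_
    by_cases hz : z ∈ X
    · simp [h y hy z hz]
    · simp [hp z hz]
  constructor <;> intro hp y hy
  · exact ⟨(hp y hy).1, by rw [← key (fun y hy => (hp y hy).1) y hy, (hp y hy).2]⟩
  · exact ⟨(hp y hy).1, by rw [key (fun y hy => (hp y hy).1) y hy, (hp y hy).2]⟩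

open Classical in
/-- An isolated vertex contributes one free coordinate to the cut kernel. -/
lemma ncard_cutKernel_insert [Fintype V] {G : SimpleGraph V} {x : V} (hx : ∀ z, ¬ G.Adj x z)
    {X : Set V} (hX : x ∉ X) : (G.cutKernel (insert x X)).ncard = 2 * (G.cutKernel X).ncard := by
  have hA : ∀ (p : V → ZMod 2) (a : ZMod 2), (G.adjMatrix (ZMod 2)).mulVec (p + Pi.single x a) =
      (G.adjMatrix (ZMod 2)).mulVec p := by
    intro p a
    funext y
    simp [-adjMatrix_mulVec_apply, Matrix.mulVec_add, Matrix.mulVec_single,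
      mt Adj.symm (hx y)]
  have hAx : ∀ p : V → ZMod 2, (G.adjMatrix (ZMod 2)).mulVec p x = 0 := by
    intro p
    simp only [Matrix.mulVec, dotProduct]
    exact Finset.sum_eq_zero fun z _ => by simp [hx z]
  have hset : G.cutKernel (insert x X) =
      G.cutKernel X ∪ (· + Pi.single x 1) '' G.cutKernel X := by
    ext p
    constructor
    · intro hp
      have hz2 : ∀ c : ZMod 2, c = 0 ∨ c = 1 := by decide
      rcases hz2 (p x) with h | h
      · refine .inl fun y hy => ?_
        rcases eq_or_ne y x with rfl | hyx
        · exact ⟨h, hAx p⟩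
        · exact hp y (by grind)
      · refine .inr ⟨p + Pi.single x 1, fun y hy => ?_, ?_⟩
        · rw [hA]
          rcases eq_or_ne y x with rfl | hyx
          · exact ⟨by simp [h, CharTwo.add_self_eq_zero], hAx p⟩
          · simpa [hyx] using hp y (by grind)
        · simp [add_assoc, ← Pi.single_add, CharTwo.add_self_eq_zero]
    · rintro (hp | ⟨p, hp, rfl⟩) y hy
      · exact hp y (by grind)
      · have hyx : y ≠ x := by grind
        simp only [hA]
        simpa [hyx] using hp y (by grind)
  rw [hset, Set.ncard_union_eq ?_ (Set.toFinite _) (Set.toFinite _),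
    Set.ncard_image_of_injective _ (add_left_injective _), two_mul]
  rw [Set.disjoint_left]
  rintro _ hp ⟨p, hp', rfl⟩
  have h1 := (hp x hX).1
  have h2 := (hp' x hX).1
  simp [h2] at h1

/-- Vertices isolated in both graphs are irrelevant to the comparison of their cut kernels. -/
lemma ncard_cutKernel_union_eq_iff [Fintype V] {G H : SimpleGraph V} {U : Set V}
    (hG : ∀ x ∈ U, ∀ z, ¬ G.Adj x z) (hH : ∀ x ∈ U, ∀ z, ¬ H.Adj x z) (X : Set V) :
    (G.cutKernel (X ∪ U)).ncard = (H.cutKernel (X ∪ U)).ncard ↔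
      (G.cutKernel X).ncard = (H.cutKernel X).ncard := by
  induction U, U.toFinite using Set.Finite.induction_on with
  | empty => simp
  | @insert x U _ _ ih =>
    rw [← ih (fun y hy => hG y (by simp [hy])) (fun y hy => hH y (by simp [hy])), Set.union_insert]
    by_cases hx : x ∈ X ∪ U
    · rw [Set.insert_eq_of_mem hx]
    · rw [ncard_cutKernel_insert (hG x (by simp)) hx, ncard_cutKernel_insert (hH x (by simp)) hx]
      omega

/-- The graph obtained from `G` by isolating all leaves attached to `w`. The vertex set is kept, so
that the construction can be iterated without changing types. -/
def detachPendants (G : SimpleGraph V) (w : V) : SimpleGraph V where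
  Adj x y := G.Adj x y ∧ ¬ G.IsPendantAt x w ∧ ¬ G.IsPendantAt y w
  symm := ⟨fun _ _ h => ⟨h.1.symm, h.2.2, h.2.1⟩⟩
  loopless := ⟨fun _ h => G.irrefl h.1⟩

lemma detachPendants_le (G : SimpleGraph V) (w : V) : G.detachPendants w ≤ G := fun _ _ h => h.1

/-- Let `U` be the set of leaves at `w`. Isolating `U` does not change the edges between `X ∪ U` and
its complement if `w ∈ X`, nor those between `X \ U` and its complement if
`w ∉ X`. As adding vertices of `U` to `X` or removing them is harmless once they are isolated, the
cut kernels of the smaller graphs are controlled by those of the larger ones. -/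
lemma CutEquivalent.detachPendants [Fintype V] {G H : SimpleGraph V} (h : G.CutEquivalent H) {w : V}
    (hU : ∀ u, G.IsPendantAt u w ↔ H.IsPendantAt u w) :
    (G.detachPendants w).CutEquivalent (H.detachPendants w) := by
  have hmem : ∀ (F : SimpleGraph V) (X : Set V), w ∈ X →
      F.cutKernel (X ∪ {u | F.IsPendantAt u w}) =
        (F.detachPendants w).cutKernel (X ∪ {u | F.IsPendantAt u w}) := by
    refine fun F X hw => cutKernel_congr fun y hy z hz => ⟨fun hyz => ⟨hyz, ?_, ?_⟩, fun h => h.1⟩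
    · exact fun h => hy (.inr h)
    · exact fun h => hy (.inl ((h y).1 hyz.symm ▸ hw))
  have hnotMem : ∀ (F : SimpleGraph V) (X : Set V), w ∉ X →
      F.cutKernel (X \ {u | F.IsPendantAt u w}) =
        (F.detachPendants w).cutKernel (X \ {u | F.IsPendantAt u w}) := by
    refine fun F X hw => cutKernel_congr fun y hy z hz => ⟨fun hyz => ⟨hyz, ?_, ?_⟩, fun h => h.1⟩
    · exact fun h => hw ((h z).1 hyz ▸ hz.1)
    · exact fun h => hz.2 h
  have hset : {u | H.IsPendantAt u w} = {u | G.IsPendantAt u w} := by ext u; exact (hU u).symm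
  have iff := ncard_cutKernel_union_eq_iff (G := G.detachPendants w) (H := H.detachPendants w)
    (U := {u | G.IsPendantAt u w}) (fun x hx z hz => hz.2.1 hx)
    (fun x hx z hz => hz.2.1 ((hU x).1 hx))
  intro X
  by_cases hw : w ∈ X
  · rw [← iff, ← hmem G X hw, ← hset, ← hmem H X hw]
    exact h _
  · rw [← iff, ← Set.sdiff_union_self, iff, ← hnotMem G X hw, ← hset, ← hnotMem H X hw]
    exact h _

/-- An end of a longest path in a forest is a leaf. -/
lemma IsAcyclic.exists_isPendantAt [Finite V] {G : SimpleGraph V} (hG : G.IsAcyclic) {a b : V}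
    (hab : G.Adj a b) : ∃ u w, G.IsPendantAt u w := by
  have : Nonempty V := ⟨a⟩
  obtain ⟨u, v, p, hp, hmax⟩ := Walk.exists_isPath_forall_isPath_length_le_length G
  have h1 := hmax a b (.cons hab .nil) (by simp [hab.ne])
  have hnil : ¬ p.Nil := by
    intro h
    rw [Walk.length_eq_zero_iff.2 h] at h1
    simp at h1
  refine ⟨u, p.snd, fun z => ⟨fun hz => ?_, fun h => h ▸ p.adj_snd hnil⟩⟩
  refine hG.eq_snd_of_adj_start hp hz ?_
  by_contra hzp
  have := hmax z v (p.cons hz.symm) (hp.cons hzp)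
  simp at this

/-- Some vertex `w` of a forest with an edge has a leaf attached and at most one neighbour that is not
a leaf: take a leaf `w` of the forest induced on the vertices that are not leaves, or the neighbour of
any leaf if that forest has no edge. -/
lemma IsAcyclic.exists_detachPendants [Finite V] {G : SimpleGraph V} (hG : G.IsAcyclic) {a b : V}
    (hab : G.Adj a b) : ∃ w, (∃ u, G.IsPendantAt u w) ∧ ((∀ z, ¬ (G.detachPendants w).Adj w z) ∨
      ∃ t, (G.detachPendants w).IsPendantAt w t ∧ ∀ x, ¬ G.IsPendantAt t x) := by
  -- `F` consists of the edges of `G` neither end of which is a leaf.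
  let F : SimpleGraph V :=
    { Adj := fun x y => G.Adj x y ∧ (∀ z, ¬ G.IsPendantAt x z) ∧ ∀ z, ¬ G.IsPendantAt y z
      symm := ⟨fun _ _ h => ⟨h.1.symm, h.2.2, h.2.1⟩⟩
      loopless := ⟨fun _ h => G.irrefl h.1⟩ }
  by_cases hF : ∃ x y, F.Adj x y
  · obtain ⟨x, y, hxy⟩ := hF
    obtain ⟨w, t, hwt⟩ := (hG.anti (fun _ _ h => h.1 : F ≤ G)).exists_isPendantAt hxy
    obtain ⟨hadj, hw, ht⟩ := hwt.adj
    have hpend : ∀ z, z ≠ t → G.Adj w z → G.IsPendantAt z w := by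
      intro z hzt hz
      by_contra hzw
      refine hzt ((hwt z).1 ⟨hz, hw, fun c hc => hzw ?_⟩)
      rwa [(hc w).1 hz.symm]
    refine ⟨w, ?_, .inr ⟨t, fun z => ⟨fun hz => ?_, ?_⟩, ht⟩⟩
    · by_contra! hn
      refine hw t fun z => ⟨fun hz => ?_, fun h => h ▸ hadj⟩
      by_contra hzt
      exact hn z (hpend z hzt hz)
    · by_contra hzt
      exact hz.2.2 (hpend z hzt hz.1)
    · rintro rfl
      exact ⟨hadj, hw w, ht w⟩
  · push Not at hF
    obtain ⟨u, w, huw⟩ := hG.exists_isPendantAt hab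
    refine ⟨w, ⟨u, huw⟩, .inl fun z hz => hF w z ⟨hz.1, fun c hc => ?_, fun c hc => ?_⟩⟩
    · have h1 := (hc u).1 huw.adj.symm
      have h2 := (hc z).1 hz.1
      exact hz.2.2 (h2.trans h1.symm ▸ huw)
    · exact hz.2.2 ((hc w).1 hz.1.symm ▸ hc)

theorem CutEquivalent.eq_of_isPendantAt_iff [Fintype V] {G H : SimpleGraph V}
    (h : G.CutEquivalent H) (hG : G.IsAcyclic) (hH : H.IsAcyclic)
    (hpend : ∀ u w, G.IsPendantAt u w ↔ H.IsPendantAt u w) : G = H := by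
  induction G using WellFoundedLT.induction generalizing H with
  | ind G ih =>
  by_cases hE : ∃ a b, G.Adj a b
  swap
  · push Not at hE
    ext a b
    refine iff_of_false (hE a b) fun hab => ?_
    obtain ⟨z, hz⟩ := h.symm.exists_adj hab
    exact hE a z hz
  obtain ⟨a, b, hab⟩ := hE
  obtain ⟨w, ⟨u, huw⟩, hw⟩ := hG.exists_detachPendants hab
  have h' := h.detachPendants fun u => hpend u w
  have hH' := hH.anti (H.detachPendants_le w)
  have hlt : G.detachPendants w < G :=
    (G.detachPendants_le w).lt_of_ne fun he => (he.ge huw.adj).2.1 huw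
  have hdet : ∀ {F : SimpleGraph V} {x : V}, x ≠ w → ¬ F.IsPendantAt x w → ∀ z,
      (F.detachPendants w).Adj x z ↔ F.Adj x z := fun hxw hx z =>
    ⟨fun hz => hz.1, fun hz => ⟨hz, hx, fun hc => hxw ((hc _).1 hz.symm)⟩⟩
  have hw' : ∀ z, (G.detachPendants w).Adj w z ↔ (H.detachPendants w).Adj w z := by
    rcases hw with hw | ⟨t, hwt, ht⟩
    · refine fun z => iff_of_false (hw z) fun hz => ?_
      obtain ⟨z', hz'⟩ := h'.symm.exists_adj hz
      exact hw z' hz'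
    -- A pendant `t` of the smaller forest from `H` would be a leaf of `H`, hence of `G`.
    · have hnot : ∀ x, ¬ (H.detachPendants w).IsPendantAt t x := fun x hx =>
        ht x ((hpend t x).2 fun z =>
          (hdet hwt.adj.ne' (fun hc => ht w ((hpend t w).2 hc)) z).symm.trans (hx z))
      rcases h'.isPendantAt_or hH' hwt with hc | hc | ⟨x, -, hc⟩
      · exact fun z => (hwt z).trans (hc z).symm
      · exact absurd hc (hnot _)
      · exact absurd hc (hnot _)
  have heq : G.detachPendants w = H.detachPendants w := by
    refine ih _ hlt h' (hG.anti hlt.le) hH' fun x y => ?_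
    by_cases hxw : x = w
    · subst hxw
      exact forall_congr' fun z => by rw [hw' z]
    by_cases hx : G.IsPendantAt x w
    · exact iff_of_false (fun hc => hc.adj.2.1 hx) fun hc => hc.adj.2.1 ((hpend x w).1 hx)
    · have hx' := fun hc => hx ((hpend x w).2 hc)
      simpa only [IsPendantAt, hdet hxw hx, hdet hxw hx'] using hpend x y
  ext x y
  by_cases hx : G.IsPendantAt x w
  · exact (hx y).trans ((hpend x w).1 hx y).symm
  by_cases hy : G.IsPendantAt y w
  · rw [G.adj_comm, H.adj_comm]
    exact (hy x).trans ((hpend y w).1 hy x).symm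
  have hxy := congrArg (fun F : SimpleGraph V => F.Adj x y) heq
  simpa [SimpleGraph.detachPendants, ← hpend, hx, hy] using hxy

/-! ### Exchanging a leaf with its neighbour -/

open Classical in
/-- Complementing locally at the neighbour `b` of a leaf `a` joins `a` to all neighbours of `b`;
complementing at `a` then restores the edges among these and detaches them from `b`. The effect is to
exchange `a` and `b`. -/
lemma IsPendantAt.localComplement_localComplement {G : SimpleGraph V} {a b : V}
    (h : G.IsPendantAt a b) :
    (G.localComplement b).localComplement a = G.comap (Equiv.swap a b) := by
  have hab := h.adj
  have ha : ∀ z, G.Adj z a ↔ z = b := fun z => (G.adj_comm z a).trans (h z)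
  have hb : ∀ z, G.Adj z b ↔ G.Adj b z := fun z => G.adj_comm z b
  have key : ∀ z, (G.localComplement b).Adj a z ↔ z ≠ a ∧ (z = b ∨ G.Adj b z) := by
    intro z
    simp only [localComplement, mem_neighborSet, h z, hab.symm, true_and]
    by_cases hzb : z = b
    · simp [hzb, hab.ne']
    · simp [hzb]
      tauto
  ext x y
  simp only [localComplement, mem_neighborSet, comap_adj] at key ⊢
  simp only [key]
  have hne := hab.ne
  by_cases hxa : x = a
  · subst hxa
    rw [Equiv.swap_apply_left]
    by_cases hya : y = x
    · subst hya; simp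
    by_cases hyb : y = b
    · subst hyb; simp [hab, hab.symm]
    · simp [Equiv.swap_apply_of_ne_of_ne hya hyb, hya, hyb, h y, hab.symm, Ne.symm hya]
  by_cases hxb : x = b
  · subst hxb
    rw [Equiv.swap_apply_right]
    by_cases hya : y = a
    · subst hya; simp [hab, hab.symm, hxa]
    by_cases hyb : y = x
    · subst hyb; simp
    · simp [Equiv.swap_apply_of_ne_of_ne hya hyb, hya, hyb, h y, hxa, Ne.symm hyb]
  rw [Equiv.swap_apply_of_ne_of_ne hxa hxb]
  by_cases hya : y = a
  · subst hya
    simp [hxa, hxb, ha x, hb x, hab.symm]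
  by_cases hyb : y = b
  · subst hyb
    simp [hxa, hxb, ha x, hb x, hab.ne']
  · rw [Equiv.swap_apply_of_ne_of_ne hya hyb]
    have := G.ne_of_adj (a := x) (b := y)
    simp only [hxa, hxb, hya, hyb, ne_eq, not_false_eq_true, true_and, false_or]
    tauto

open Classical in
lemma IsPendantAt.cutEquivalent_comap_swap [Fintype V] {G : SimpleGraph V} {a b : V}
    (h : G.IsPendantAt a b) : G.CutEquivalent (G.comap (Equiv.swap a b)) := by
  rw [← h.localComplement_localComplement]
  exact (cutEquivalent_localComplement G b).trans (cutEquivalent_localComplement _ a)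

lemma isPendantAt_comap {G : SimpleGraph V} (σ : V ≃ V) {u w : V} :
    (G.comap σ).IsPendantAt u w ↔ G.IsPendantAt (σ u) (σ w) := by
  simp only [IsPendantAt, comap_adj]
  exact ⟨fun h z => by simpa [Equiv.symm_apply_eq] using h (σ.symm z), fun h z => by simp [h]⟩

/-- Isolated edges are preserved by cut-equivalence, since no edge leaves their pair of ends. -/
lemma CutEquivalent.isPendantAt_of_mutual [Fintype V] {G H : SimpleGraph V}
    (h : G.CutEquivalent H) {u w : V} (huw : G.IsPendantAt u w) (hwu : G.IsPendantAt w u) :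
    H.IsPendantAt u w := by
  have hout := h.not_adj_of_not_adj (X := {u, w}) (by
    rintro x (rfl | rfl) y hy hxy
    · exact hy (.inr ((huw y).1 hxy))
    · exact hy (.inl ((hwu y).1 hxy))) u (by simp)
  have hz : ∀ z, H.Adj u z → z = w := fun z hz => by
    by_contra hzw
    exact hout z (by simp [hzw, hz.ne']) hz
  obtain ⟨c, hc⟩ := h.exists_adj huw.adj
  exact fun z => ⟨hz z, fun h => h.trans (hz c hc).symm ▸ hc⟩

open Classical in
/-- A pair that is pendant in `G` but not in `H` can be made pendant in `H` by exchanging a leaf of `H`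
with its neighbour, without destroying any pendant pair common to `G` and `H`. -/
lemma CutEquivalent.exists_swap [Fintype V] {G H : SimpleGraph V} (h : G.CutEquivalent H)
    (hG : G.IsAcyclic) (hH : H.IsAcyclic) {u w : V} (huw : G.IsPendantAt u w)
    (hn : ¬ H.IsPendantAt u w) :
    ∃ a b, H.IsPendantAt a b ∧ (H.comap (Equiv.swap a b)).IsPendantAt u w ∧
      ∀ p q, G.IsPendantAt p q → H.IsPendantAt p q →
        (H.comap (Equiv.swap a b)).IsPendantAt p q := by
  have hne := huw.adj.ne
  rcases h.isPendantAt_or hH huw with hc | hwu | ⟨x, hux, hwx⟩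
  · exact absurd hc hn
  · have hmut : ¬ G.IsPendantAt w u := fun hc => hn (h.isPendantAt_of_mutual huw hc)
    refine ⟨w, u, hwu, isPendantAt_comap _ |>.2 (by simpa), fun p q hp hp' => ?_⟩
    have h1 : p ≠ u := by
      rintro rfl
      exact hn ((huw q).1 hp.adj ▸ hp')
    have h2 : p ≠ w := by
      rintro rfl
      exact hmut ((hwu q).1 hp'.adj ▸ hp)
    have h3 : q ≠ u := by
      rintro rfl
      exact h2 ((huw p).1 hp.adj.symm)
    have h4 : q ≠ w := by
      rintro rfl
      exact h1 ((hwu p).1 hp'.adj.symm)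
    rw [isPendantAt_comap, Equiv.swap_apply_of_ne_of_ne h2 h1, Equiv.swap_apply_of_ne_of_ne h4 h3]
    exact hp'
  · have hxw : x ≠ w := hwx.adj.ne'
    refine ⟨w, x, hwx, ?_, fun p q hp hp' => ?_⟩
    · rw [isPendantAt_comap, Equiv.swap_apply_left, Equiv.swap_apply_of_ne_of_ne hne hux.adj.ne]
      exact hux
    have h1 : p ≠ w := by
      rintro rfl
      obtain rfl := (hwx q).1 hp'.adj
      exact hux.adj.ne ((hp u).1 huw.adj.symm)
    have h2 : p ≠ x := by
      rintro rfl
      exact hne (((hp' u).1 hux.adj.symm).trans ((hp' w).1 hwx.adj.symm).symm)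
    have h3 : q ≠ w := by
      rintro rfl
      exact h2 ((hwx p).1 hp'.adj.symm)
    have h4 : q ≠ x := by
      rintro rfl
      rcases h.symm.isPendantAt_or hG hux with hc | hc | ⟨y, hc, hc'⟩
      · exact hxw ((huw q).1 hc.adj)
      · exact hxw ((huw q).1 hc.adj.symm)
      · obtain rfl := (huw y).1 hc.adj
        exact h1 ((hc' p).1 hp.adj.symm)
    rw [isPendantAt_comap, Equiv.swap_apply_of_ne_of_ne h1 h2, Equiv.swap_apply_of_ne_of_ne h3 h4]
    exact hp'

/-- Induction on the number of pairs that are pendant in `G` but not in `H`. -/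
lemma CutEquivalent.exists_iso_isPendantAt [Fintype V] {G H : SimpleGraph V}
    (h : G.CutEquivalent H) (hG : G.IsAcyclic) (hH : H.IsAcyclic) :
    ∃ K : SimpleGraph V, Nonempty (K ≃g H) ∧ G.CutEquivalent K ∧
      ∀ u w, G.IsPendantAt u w → K.IsPendantAt u w := by
  classical
  induction hm : {e : V × V | G.IsPendantAt e.1 e.2 ∧ ¬ H.IsPendantAt e.1 e.2}.ncard
    using Nat.strong_induction_on generalizing H with
  | _ n ih =>
  subst hm
  by_cases hall : ∀ u w, G.IsPendantAt u w → H.IsPendantAt u w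
  · exact ⟨H, ⟨.refl⟩, h, hall⟩
  push Not at hall
  obtain ⟨u, w, huw, hn⟩ := hall
  obtain ⟨a, b, hab, hnew, hold⟩ := h.exists_swap hG hH huw hn
  let e : H.comap (Equiv.swap a b) ≃g H := Iso.comap _ H
  have hlt : {e : V × V | G.IsPendantAt e.1 e.2 ∧
        ¬ (H.comap (Equiv.swap a b)).IsPendantAt e.1 e.2}.ncard <
      {e : V × V | G.IsPendantAt e.1 e.2 ∧ ¬ H.IsPendantAt e.1 e.2}.ncard := by
    refine Set.ncard_lt_ncard ?_ (Set.toFinite _)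
    refine (Set.ssubset_iff_of_subset ?_).2 ⟨(u, w), ⟨huw, hn⟩, fun hc => hc.2 hnew⟩
    exact fun c hc => ⟨hc.1, fun hc' => hc.2 (hold _ _ hc.1 hc')⟩
  obtain ⟨K, ⟨f⟩, hK⟩ :=
    ih _ hlt (h.trans hab.cutEquivalent_comap_swap) (e.isAcyclic_iff.2 hH) rfl
  exact ⟨K, ⟨f.trans e⟩, hK⟩

lemma CutEquivalent.isPendantAt_iff [Fintype V] {G H : SimpleGraph V}
    (h : G.CutEquivalent H) (hG : G.IsAcyclic)
    (hsub : ∀ u w, G.IsPendantAt u w → H.IsPendantAt u w) (u w : V) :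
    G.IsPendantAt u w ↔ H.IsPendantAt u w := by
  refine ⟨hsub u w, fun huw => ?_⟩
  rcases h.symm.isPendantAt_or hG huw with hc | hc | ⟨x, hux, hwx⟩
  · exact hc
  · exact h.symm.isPendantAt_of_mutual huw (hsub w u hc)
  · obtain rfl := (huw x).1 (hsub u x hux).adj
    exact absurd hwx.adj (G.irrefl)

theorem CutEquivalent.nonempty_iso [Fintype V] {G H : SimpleGraph V}
    (h : G.CutEquivalent H) (hG : G.IsAcyclic) (hH : H.IsAcyclic) : Nonempty (G ≃g H) := by
  obtain ⟨K, ⟨f⟩, hGK, hsub⟩ := h.exists_iso_isPendantAt hG hH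
  obtain rfl := hGK.eq_of_isPendantAt_iff hG (f.isAcyclic_iff.2 hH) (hGK.isPendantAt_iff hG hsub)
  exact ⟨f⟩

end SimpleGraph


theorem corollary1p5 {V : Type*} [Finite V] (G H : SimpleGraph V)
    (hG : G.IsTree) (hH : H.IsTree) (hGH : G.LocallyEquivalent H) :
    Nonempty (G ≃g H) := by
  have := Fintype.ofFinite V
  exact hGH.cutEquivalent.nonempty_iso hG.isAcyclic hH.isAcyclic
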